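/- Let $p\neq q$ be prime numbers, let $k\ge 0$ be an integer, and let $\Delta\subset\mathbb R^d$ be a lattice simplex of dimension $d$, i.e. the convex hull of $d+1$ affinely independent points $v_0,\dots,v_d\in\mathbb Z^d$. Its $\delta$-polynomial is the polynomial $\delta(\Delta,t)$ with $$\delta(\Delta,t)=(1-t)^{d+1}\Bigl(1+\sum_{n\ge 1}|n\Delta\cap\mathbb Z^d|\,t^n\Bigr),$$ and the finite abelian group associated with $\Delta$ is $$\Lambda_\Delta=\Bigl\{(\lambda_0,\dots,\lambda_d)\in(\mathbb R/\mathbb Z)^{d+1} : \sum_{i=0}^d\lambda_i(v_i,1)\in\mathbb Z^{d+1}\Bigr\}.$$ Two sets $P,Q\subset\mathbb R^d$ are unimodularly equivalent if $Q=\{vU+w : v\in P\}$ for some integer matrix $U$ with $\det U=\pm1$ and some $w\in\mathbb Z^d$. The simplex $\Delta$ is called a lattice pyramid if $d\ge1$ and $\Delta$ is unimodularly equivalent to $\mathrm{conv}\bigl((\Delta'\times\{0\})\cup\{(0,\dots,0,1)\}\bigr)$ for some lattice simplex $\Delta'\subset\mathbb R^{d-1}$ of dimension $d-1$. Suppose that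 $\delta(\Delta,t)=1+t^{k+1}+t^{2(k+1)}+\cdots+t^{(pq-1)(k+1)}$ and that $\Delta$ is not a lattice pyramid. Then at least one of the following holds, where "generated by $x$" means that $\Lambda_\Delta$ is the cyclic group generated by a vector obtained from $x\in(\mathbb R/\mathbb Z)^{d+1}$ by a permutation of the coordinates: 1. $d=pq(k+1)-1$ and $\Lambda_\Delta$ is generated by $(1/(pq),\dots,1/(pq))$; 2. $d=pq(k+1)+p(k+1)-1$ and $\Lambda_\Delta$ is generated by $(\underbrace{1/p,\dots,1/p}_{p(k+1)},\underbrace{1/q,\dots,1/q}_{pq(k+1)})$; 3. $d=pq(k+1)+q(k+1)-1$ and $\Lambda_\Delta$ is generated by $(\underbrace{1/q,\dots,1/q}_{q(k+1)},\underbrace{1/p,\dots,1/p}_{pq(k+1)})$; 4. $d=pq(k+1)+(p-1)(k+1)-1$ and $\Lambda_\Delta$ is generated by $(\underbrace{1/q,\dots,1/q}_{(pq-1)(k+1)},\underbrace{1/(pq),\dots,1/(pq)}_{p(k+1)})$; 5. $d=pq(k+1)+(q-1)(k+1)-1$ and $\Lambda_\Delta$ is generated by $(\underbrace{1/p,\dots,1/p}_{(pq-1)(k+1)},\underbrace{1/(pq),\dots,1/(pq)}_{q(k+1)})$.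 -/

import Mathlib

open scoped Pointwise

noncomputable section

/-- A lattice simplex of full dimension `d` in `ℝ^d`, together with an ordering `v₀, …, v_d` of its
vertices, which are integer points and are affinely independent over `ℝ`. -/
structure LatticeSimplex (d : ℕ) where
  /-- the vertices -/
  vertex : Fin (d + 1) → Fin d → ℤ
  affineIndependent : AffineIndependent ℝ (fun i j => (vertex i j : ℝ) : Fin (d + 1) → Fin d → ℝ)

/-- The number of points of `ℤ^d` in `P ⊆ ℝ^d`. -/
def latticePointCount {d : ℕ} (P : Set (Fin d → ℝ)) : ℕ :=
  {z : Fin d → ℤ | (fun j => (z j : ℝ)) ∈ P}.ncard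

/-- The Ehrhart series `1 + ∑_{n ≥ 1} |nP ∩ ℤ^d| t^n`. -/
def ehrhartSeries {d : ℕ} (P : Set (Fin d → ℝ)) : PowerSeries ℤ :=
  PowerSeries.mk fun n => if n = 0 then 1 else (latticePointCount ((n : ℝ) • P) : ℤ)

/-- `f` is the `δ`-polynomial of the `d`-dimensional lattice polytope `P ⊆ ℝ^d`:
`f(t) = (1 - t)^(d+1) (1 + ∑_{n ≥ 1} |nP ∩ ℤ^d| t^n)` as formal power series. -/
def HasDeltaPolynomial {d : ℕ} (P : Set (Fin d → ℝ)) (f : Polynomial ℤ) : Prop :=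
  (f : PowerSeries ℤ) = (1 - PowerSeries.X) ^ (d + 1) * ehrhartSeries P

/-- `P` and `Q` are unimodularly equivalent: `Q = f_U(P) + w` with `f_U(v) = v U` for an integer
matrix `U` of determinant `±1` and an integer vector `w`. -/
def UnimodularlyEquivalent {d : ℕ} (P Q : Set (Fin d → ℝ)) : Prop :=
  ∃ (U : Matrix (Fin d) (Fin d) ℤ) (w : Fin d → ℤ), (U.det = 1 ∨ U.det = -1) ∧
    Q = (fun v : Fin d → ℝ =>
      Matrix.vecMul v (U.map (fun z : ℤ => (z : ℝ))) + fun j => (w j : ℝ)) '' P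

/-- `Pyr(P) = conv(P × {0}, (0, …, 0, 1)) ⊆ ℝ^(d+1)`. -/
def latticePyramid {d : ℕ} (P : Set (Fin d → ℝ)) : Set (Fin (d + 1) → ℝ) :=
  convexHull ℝ
    (insert (Pi.single (Fin.last d) 1)
      ((fun x : Fin d → ℝ => (Fin.snoc x 0 : Fin (d + 1) → ℝ)) '' P))

namespace LatticeSimplex

/-- The simplex as a subset of `ℝ^d`. -/
def toSet {d : ℕ} (S : LatticeSimplex d) : Set (Fin d → ℝ) :=
  convexHull ℝ (Set.range fun (i : Fin (d + 1)) (j : Fin d) => (S.vertex i j : ℝ))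

/-- `S` is, up to unimodular equivalence, the lattice pyramid over a lattice simplex of dimension
one less (a simplex of dimension `0` never is). -/
def IsLatticePyramid : {d : ℕ} → LatticeSimplex d → Prop
  | 0, _ => False
  | e + 1, S => ∃ T : LatticeSimplex e, UnimodularlyEquivalent (latticePyramid T.toSet) S.toSet

/-- The group `Λ_S` of all `(λ₀, …, λ_d) ∈ (ℝ/ℤ)^(d+1)` with `∑ λ_i (v_i, 1) ∈ ℤ^(d+1)`; this says
that each of the `d + 1` coordinates of the sum is `0` in `ℝ/ℤ`. -/
def Lam {d : ℕ} (S : LatticeSimplex d) : AddSubgroup (Fin (d + 1) → UnitAddCircle) where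
  carrier := {x | (∀ j : Fin d, ∑ i, S.vertex i j • x i = 0) ∧ ∑ i, x i = 0}
  zero_mem' := by simp
  add_mem' := by
    rintro x y ⟨hx, hx'⟩ ⟨hy, hy'⟩
    refine ⟨fun j => ?_, ?_⟩
    · simp [smul_add, Finset.sum_add_distrib, hx j, hy j]
    · simp [Finset.sum_add_distrib, hx', hy']
  neg_mem' := by
    rintro x ⟨hx, hx'⟩
    refine ⟨fun j => ?_, ?_⟩
    · simp [smul_neg, Finset.sum_neg_distrib, hx j]
    · simp [Finset.sum_neg_distrib, hx']

/-- `Λ_S` is generated by the single element `w`, up to a permutation of the coordinates. -/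
def LamGeneratedBy {d : ℕ} (S : LatticeSimplex d) (w : Fin (d + 1) → UnitAddCircle) : Prop :=
  ∃ σ : Equiv.Perm (Fin (d + 1)), S.Lam = AddSubgroup.zmultiples (w ∘ σ)

end LatticeSimplex

/-- The vector `(a, …, a, b, …, b)` in `(ℝ/ℤ)^n` with `m` entries `a` followed by `n - m`
entries `b`. -/
def twoBlocks (n m : ℕ) (a b : ℝ) : Fin n → UnitAddCircle :=
  fun i => if (i : ℕ) < m then (a : UnitAddCircle) else (b : UnitAddCircle)

end

/-! Write m = k + 1, and let the height of an element of Λ be the sum of the representatives in [0,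
1) of its coordinates. Splitting barycentric coordinates into fractional and integral parts shows
that the δ-coefficients count Λ by height (`coeff_eq_ncard_heightSet`). Hence Λ has pq elements,
exactly one of each height 0, m, ..., (pq-1)m.

Height is subadditive. If distinct elements e_t of Λ have height at most tm, uniqueness forces
equality (`circleHeight_eq_of_le`), and equality means that no coordinate carries past 1. Let x be
the element of height m; its order is pq, p or q. If it is pq, the bound for (pq-1)x forces every
coordinate of x to be 0 or 1/(pq). If it is p, take y of height pm: the elements jx + iy with j < p,
i < q exhaust Λ, and the absence of carries in (p-1)x + (q-1)y leaves very few coordinates. The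
cases qy = 0 and qy ≠ 0 give the two kinds of two-block generators; order q is symmetric. Heights
then determine the block sizes, hence d.

A coordinate that vanishes on all of Λ would make Δ a lattice pyramid
(`isLatticePyramid_of_forall_eq_zero`), so it is excluded. -/

/-! ### Fractional representatives and their subadditivity. -/

/-- The representative in `[0, 1)` of an element of `ℝ/ℤ`. -/
noncomputable def circleFract (x : UnitAddCircle) : ℝ := (AddCircle.equivIco (1 : ℝ) 0 x : ℝ)

theorem circleFract_nonneg (x : UnitAddCircle) : 0 ≤ circleFract x :=
  (AddCircle.equivIco (1 : ℝ) 0 x).2.1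

theorem circleFract_lt_one (x : UnitAddCircle) : circleFract x < 1 :=
  (AddCircle.equivIco (1 : ℝ) 0 x).2.2.trans_eq (zero_add 1)

theorem coe_circleFract (x : UnitAddCircle) : (circleFract x : UnitAddCircle) = x :=
  AddCircle.coe_equivIco

theorem circleFract_coe (r : ℝ) : circleFract (r : UnitAddCircle) = Int.fract r := by
  simp [circleFract, AddCircle.coe_equivIco_mk_apply]

@[simp] theorem circleFract_zero : circleFract 0 = 0 := by
  have := circleFract_coe 0
  simpa using this

theorem circleFract_coe_le {r : ℝ} (hr : 0 ≤ r) : circleFract (r : UnitAddCircle) ≤ r := by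
  rw [circleFract_coe, Int.fract]
  have : (0 : ℝ) ≤ (⌊r⌋ : ℝ) := by exact_mod_cast Int.floor_nonneg.2 hr
  linarith

theorem circleFract_coe_of_lt {r : ℝ} (hr : 0 ≤ r) (h : r < 1) :
    circleFract (r : UnitAddCircle) = r := by
  rw [circleFract_coe, Int.fract_eq_self.2 ⟨hr, h⟩]

theorem circleFract_combination_le (a b : ℕ) (x y : UnitAddCircle) :
    circleFract (a • x + b • y) ≤ a * circleFract x + b * circleFract y := by
  have h : a • x + b • y =
      ((a * circleFract x + b * circleFract y : ℝ) : UnitAddCircle) := by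
    conv_lhs => rw [← coe_circleFract x, ← coe_circleFract y]
    simp [← nsmul_eq_mul]
  rw [h]
  apply circleFract_coe_le
  have := circleFract_nonneg x
  have := circleFract_nonneg y
  positivity

theorem exists_circleFract_eq_div {n : ℕ} (hn : 0 < n) {x : UnitAddCircle} (hx : n • x = 0) :
    ∃ l : ℕ, circleFract x = l / n := by
  rw [← coe_circleFract x, ← AddCircle.coe_nsmul, AddCircle.coe_eq_zero_iff] at hx
  obtain ⟨k, hk⟩ := hx
  have hn' : (0 : ℝ) < n := by exact_mod_cast hn
  simp only [zsmul_eq_mul, mul_one, nsmul_eq_mul] at hk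
  have hk0 : 0 ≤ k := by
    have : (0 : ℝ) ≤ k := by rw [hk]; have := circleFract_nonneg x; positivity
    exact_mod_cast this
  lift k to ℕ using hk0
  refine ⟨k, ?_⟩
  rw [eq_div_iff hn'.ne', mul_comm, ← hk]
  simp

/-- The representative is l/(rn), and the bound says (n-1)l < n, which fails for l ≥ 2 because n ≥
2. -/
theorem eq_zero_or_eq_one_div {r n : ℕ} (hr : 0 < r) (hn : 2 ≤ n) {x : UnitAddCircle}
    (hx : (r * n) • x = 0) (h : (n - 1 : ℝ) * circleFract x < 1 / r) :
    x = 0 ∨ x = ((1 / (r * n : ℝ) : ℝ) : UnitAddCircle) := by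
  obtain ⟨l, hl⟩ := exists_circleFract_eq_div (by positivity) hx
  have hr' : (0 : ℝ) < r := by exact_mod_cast hr
  have hn' : (2 : ℝ) ≤ n := by exact_mod_cast hn
  have hl2 : l < 2 := by
    by_contra! h2
    have h2' : (2 : ℝ) ≤ l := by exact_mod_cast h2
    rw [hl] at h
    push_cast at h
    rw [lt_div_iff₀ hr'] at h
    have : (n - 1 : ℝ) * (l / (r * n)) * r = (n - 1) * l / n := by field_simp
    rw [this, div_lt_one (by linarith)] at h
    nlinarith
  rw [← coe_circleFract x, hl]
  interval_cases l
  · left; simp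
  · right; push_cast; rfl

/-- The sum of the representatives in `[0, 1)` of the coordinates. -/
noncomputable def circleHeight {ι : Type*} [Fintype ι] (x : ι → UnitAddCircle) : ℝ :=
  ∑ i, circleFract (x i)

theorem circleHeight_nonneg {ι : Type*} [Fintype ι] (x : ι → UnitAddCircle) :
    0 ≤ circleHeight x := Finset.sum_nonneg fun _ _ => circleFract_nonneg _

theorem circleHeight_combination_le {ι : Type*} [Fintype ι] (a b : ℕ) (x y : ι → UnitAddCircle) :
    circleHeight (a • x + b • y) ≤ a * circleHeight x + b * circleHeight y := by
  simp only [circleHeight, Finset.mul_sum, ← Finset.sum_add_distrib]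
  exact Finset.sum_le_sum fun i _ => circleFract_combination_le a b (x i) (y i)

/-- Equality of the sums of termwise inequalities forces equality in every term: no coordinate
carries. -/
theorem circleFract_combination_eq {ι : Type*} [Fintype ι] {a b : ℕ} {x y : ι → UnitAddCircle}
    (h : circleHeight (a • x + b • y) = a * circleHeight x + b * circleHeight y) (i : ι) :
    circleFract (a • x i + b • y i) = a * circleFract (x i) + b * circleFract (y i) := by
  simp only [circleHeight, Finset.mul_sum, ← Finset.sum_add_distrib] at h
  exact (Finset.sum_eq_sum_iff_of_le
    fun i _ => circleFract_combination_le a b (x i) (y i)).1 h i (Finset.mem_univ i)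

/-! ### Subgroups of the torus with one element of each height. -/

/-- The height takes each of the values `0, m, 2m, …, (N-1)m` exactly once on `Λ`, and no others. -/
structure HasUniformHeights {ι : Type*} [Fintype ι] (Λ : AddSubgroup (ι → UnitAddCircle))
    (N m : ℕ) : Prop where
  inj : ∀ x ∈ Λ, ∀ y ∈ Λ, circleHeight x = circleHeight y → x = y
  val : ∀ x ∈ Λ, ∃ t < N, circleHeight x = t * m
  surj : ∀ t < N, ∃ x ∈ Λ, circleHeight x = t * m

namespace HasUniformHeights

variable {ι : Type*} [Fintype ι] {Λ : AddSubgroup (ι → UnitAddCircle)} {N m : ℕ}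

theorem natCard_eq (h : HasUniformHeights Λ N m) (hm : 0 < m) : Nat.card Λ = N := by
  choose f hf hf' using h.surj
  have hm' : (m : ℝ) ≠ 0 := by exact_mod_cast hm.ne'
  have : Function.Bijective (fun t : Fin N => (⟨f t t.2, hf t t.2⟩ : Λ)) := by
    constructor
    · intro s t hst
      have h1 : f s s.2 = f t t.2 := congrArg Subtype.val hst
      have h2 := hf' s s.2
      rw [h1, hf' t t.2] at h2
      have h3 := mul_right_cancel₀ hm' h2
      exact Fin.ext (by exact_mod_cast h3.symm)
    · rintro ⟨z, hz⟩
      obtain ⟨t, ht, hzt⟩ := h.val z hz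
      exact ⟨⟨t, ht⟩, Subtype.ext (h.inj _ (hf t ht) _ hz (by rw [hf' t ht, hzt]))⟩
  rw [← Nat.card_eq_of_bijective _ this, Nat.card_fin]

/-- The height of e_t is sm with s ≤ t. If s < t, then by induction e_s already has that height, so
e_s = e_t, against distinctness. -/
theorem circleHeight_eq_of_le (h : HasUniformHeights Λ N m) (hm : 0 < m)
    {e : ℕ → ι → UnitAddCircle} {n : ℕ} (he : ∀ t < n, e t ∈ Λ)
    (hinj : ∀ s < n, ∀ t < n, e s = e t → s = t)
    (hle : ∀ t < n, circleHeight (e t) ≤ t * m) :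
    ∀ t < n, circleHeight (e t) = t * m := by
  intro t
  induction t using Nat.strong_induction_on with
  | _ t ih =>
    intro ht
    obtain ⟨s, -, hs⟩ := h.val _ (he t ht)
    have hst := hle t ht
    rw [hs] at hst
    have hm' : (0 : ℝ) < m := by exact_mod_cast hm
    have hst' : s ≤ t := by exact_mod_cast le_of_mul_le_mul_right hst hm'
    rcases hst'.lt_or_eq with h1 | h1
    · have h2 := ih s h1 (h1.trans ht)
      have := hinj _ (h1.trans ht) _ ht
        (h.inj _ (he s (h1.trans ht)) _ (he t ht) (h2.trans hs.symm))
      omega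
    · rw [hs, h1]

theorem exists_eq_of_forall_eq (h : HasUniformHeights Λ N m)
    {e : ℕ → ι → UnitAddCircle} (he : ∀ t < N, e t ∈ Λ)
    (hh : ∀ t < N, circleHeight (e t) = t * m) {z : ι → UnitAddCircle} (hz : z ∈ Λ) :
    ∃ t < N, z = e t := by
  obtain ⟨t, ht, hzt⟩ := h.val z hz
  exact ⟨t, ht, h.inj _ hz _ (he t ht) (hzt.trans (hh t ht).symm)⟩

theorem circleHeight_nsmul (h : HasUniformHeights Λ N m) (hm : 0 < m) {x : ι → UnitAddCircle}
    (hx : x ∈ Λ) (hxm : circleHeight x = m) :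
    ∀ t < addOrderOf x, circleHeight (t • x) = t * m := by
  refine h.circleHeight_eq_of_le hm (fun t _ => Λ.nsmul_mem hx t) ?_ ?_
  · intro s hs t ht hst
    exact nsmul_injOn_Iio_addOrderOf hs ht hst
  · intro t _
    simpa [hxm] using circleHeight_combination_le t 0 x 0

theorem nsmul_eq_zero (h : HasUniformHeights Λ N m) (hm : 0 < m) {x : ι → UnitAddCircle}
    (hx : x ∈ Λ) : N • x = 0 := by
  have := card_nsmul_eq_zero' (x := (⟨x, hx⟩ : Λ))
  rw [h.natCard_eq hm] at this
  exact congrArg Subtype.val this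

/-- If the element of height `m` generates, all of its coordinates are `1 / N`. -/
theorem eq_zmultiples_of_addOrderOf_eq (h : HasUniformHeights Λ N m) (hm : 0 < m) (hN : 2 ≤ N)
    (hsupp : ∀ i, ∃ x ∈ Λ, x i ≠ 0) {x : ι → UnitAddCircle}
    (hx : x ∈ Λ) (hxm : circleHeight x = m) (hord : addOrderOf x = N) :
    Fintype.card ι = N * m ∧
      Λ = AddSubgroup.zmultiples (fun _ => ((1 / N : ℝ) : UnitAddCircle)) := by
  have hh := h.circleHeight_nsmul hm hx hxm
  rw [hord] at hh
  have hall := fun z hz => h.exists_eq_of_forall_eq (fun t _ => Λ.nsmul_mem hx t) hh (z := z) hz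
  have hN0 : (0 : ℝ) < N := by positivity
  have hcast : ((N - 1 : ℕ) : ℝ) = N - 1 := by push_cast [Nat.cast_sub (by omega : 1 ≤ N)]; ring
  have hxi : x = fun _ => ((1 / N : ℝ) : UnitAddCircle) := by
    funext i
    -- The last multiple of x attains the subadditive bound, so (N-1) times each representative
    -- stays below 1. The term `0 • 0` only fits the two-term lemma.
    have h1 : circleHeight ((N - 1) • x + 0 • (0 : ι → UnitAddCircle)) =
        (N - 1 : ℕ) * circleHeight x + (0 : ℕ) * circleHeight (0 : ι → UnitAddCircle) := by
      simpa [hxm] using hh (N - 1) (by omega)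
    have h2 := circleFract_combination_eq h1 i
    have h3 := circleFract_lt_one ((N - 1) • x i + 0 • (0 : ι → UnitAddCircle) i)
    rw [h2, hcast] at h3
    have h4 := eq_zero_or_eq_one_div (r := 1) one_pos hN (x := x i)
      (by simpa using congrFun (h.nsmul_eq_zero hm hx) i) (by simpa using h3)
    obtain ⟨z, hz, hzi⟩ := hsupp i
    obtain ⟨t, -, rfl⟩ := hall z hz
    rcases h4 with h4 | h4
    · simp [h4] at hzi
    · simpa using h4
  constructor
  · rw [hxi, circleHeight] at hxm
    rw [circleFract_coe_of_lt (by positivity)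
      (by rw [div_lt_one hN0]; exact_mod_cast hN)] at hxm
    simp only [Finset.sum_const, Finset.card_univ, nsmul_eq_mul] at hxm
    field_simp at hxm
    exact_mod_cast hxm
  · rw [← hxi]
    apply le_antisymm
    · intro z hz
      obtain ⟨t, -, rfl⟩ := hall z hz
      exact AddSubgroup.nsmul_mem_zmultiples x t
    · simpa using hx

/-- If `x` has height `m` and prime order `p`, and `y` has height `p m`, then the combinations
`j x + i y` with `j < p`, `i < q` are the elements of `Λ`, and their heights are `(j + p i) m`. -/
theorem circleHeight_mod_div {p q : ℕ} (h : HasUniformHeights Λ (p * q) m) (hm : 0 < m)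
    (hp : p.Prime) (hq : q.Prime) {x y : ι → UnitAddCircle}
    (hx : x ∈ Λ) (hxm : circleHeight x = m) (hord : addOrderOf x = p)
    (hy : y ∈ Λ) (hym : circleHeight y = p * m) :
    q • y ∈ AddSubgroup.zmultiples x ∧
    ∀ t < p * q, circleHeight ((t % p) • x + (t / p) • y) = t * m := by
  have hm' : (m : ℝ) ≠ 0 := by exact_mod_cast hm.ne'
  have hfin : IsOfFinAddOrder x := by rw [← addOrderOf_pos_iff, hord]; exact hp.pos
  -- The multiples of x have heights jm with j < p, never pm.
  have hxy : y ∉ AddSubgroup.zmultiples x := by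
    intro hmem
    rw [hfin.mem_zmultiples_iff_mem_range_addOrderOf] at hmem
    simp only [Finset.mem_image, Finset.mem_range] at hmem
    obtain ⟨j, hj, rfl⟩ := hmem
    rw [h.circleHeight_nsmul hm hx hxm j hj] at hym
    have := mul_right_cancel₀ hm' hym
    have : j = p := by exact_mod_cast this
    omega
  -- The subgroup generated by x has index q in Λ.
  have hqy : q • y ∈ AddSubgroup.zmultiples x := by
    set K := (AddSubgroup.zmultiples x).addSubgroupOf Λ with hK
    have hKc : Nat.card K = p := by
      have hle : AddSubgroup.zmultiples x ≤ Λ := by simpa using hx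
      rw [Nat.card_congr (AddSubgroup.addSubgroupOfEquivOfLe hle).toEquiv, Nat.card_zmultiples,
        hord]
    have hidx := K.index_mul_card
    rw [h.natCard_eq hm, hKc, mul_comm p q] at hidx
    have hidx' := Nat.eq_of_mul_eq_mul_right hp.pos hidx
    have := K.nsmul_index_mem ⟨y, hy⟩
    rw [hidx'] at this
    exact AddSubgroup.mem_addSubgroupOf.1 this
  refine ⟨hqy, h.circleHeight_eq_of_le hm
    (fun t _ => Λ.add_mem (Λ.nsmul_mem hx _) (Λ.nsmul_mem hy _)) ?_ ?_⟩
  · have hdiv : ∀ s t : ℕ, s < p * q → t < p * q →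
        (s % p) • x + (s / p) • y = (t % p) • x + (t / p) • y → s / p = t / p := by
      intro s t hs ht hst
      by_contra hne
      have hs' := Nat.div_lt_of_lt_mul hs
      have ht' := Nat.div_lt_of_lt_mul ht
      -- A multiple of y by a nonzero integer smaller than q in absolute value would lie in the span
      -- of x; so does qy, and Bézout would put y there.
      have hmem : ((s / p : ℕ) - (t / p : ℕ) : ℤ) • y ∈ AddSubgroup.zmultiples x := by
        refine ⟨(t % p : ℕ) - (s % p : ℕ), ?_⟩
        simp only [sub_smul, natCast_zsmul]
        rw [sub_eq_sub_iff_add_eq_add, ← hst, add_comm]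
      have hcop : IsCoprime ((s / p : ℕ) - (t / p : ℕ) : ℤ) (q : ℤ) := by
        rw [isCoprime_comm, Int.prime_iff_natAbs_prime.2 (by simpa using hq) |>.coprime_iff_not_dvd]
        intro hd
        generalize s / p = a at *
        generalize t / p = b at *
        have := Int.eq_zero_of_abs_lt_dvd hd (by rw [abs_lt]; omega)
        omega
      obtain ⟨a, b, hab⟩ := hcop
      apply hxy
      have : y = a • (((s / p : ℕ) - (t / p : ℕ) : ℤ) • y) + b • (q • y) := by
        rw [← natCast_zsmul, smul_smul, smul_smul, ← add_smul, hab, one_smul]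
      rw [this]
      exact add_mem (AddSubgroup.zsmul_mem _ hmem _) (AddSubgroup.zsmul_mem _ hqy _)
    intro s hs t ht hst
    have h1 := hdiv s t hs ht hst
    rw [h1, add_left_inj] at hst
    have h2 : s % p = t % p := nsmul_injOn_Iio_addOrderOf
      (by rw [hord]; exact Nat.mod_lt _ hp.pos) (by rw [hord]; exact Nat.mod_lt _ hp.pos) hst
    rw [← Nat.mod_add_div s p, ← Nat.mod_add_div t p, h1, h2]
  · intro t _
    refine (circleHeight_combination_le _ _ x y).trans (le_of_eq ?_)
    rw [hxm, hym]
    conv_rhs => rw [← Nat.mod_add_div t p]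
    push_cast
    ring

end HasUniformHeights

theorem nsmul_coe_one_div {q : ℕ} (hq : 0 < q) (r : ℝ) :
    q • ((1 / (r * q) : ℝ) : UnitAddCircle) = ((1 / r : ℝ) : UnitAddCircle) := by
  rw [← AddCircle.coe_nsmul, nsmul_eq_mul]
  have : (q : ℝ) ≠ 0 := by positivity
  congr 1
  field_simp

theorem nsmul_coe_one_div_self {q : ℕ} (hq : 0 < q) :
    q • ((1 / q : ℝ) : UnitAddCircle) = 0 := by
  have := nsmul_coe_one_div hq 1
  rw [one_mul, div_one] at this
  rw [this, AddCircle.coe_period]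

theorem circleFract_one_div {n : ℕ} (hn : 2 ≤ n) :
    circleFract ((1 / n : ℝ) : UnitAddCircle) = 1 / n := by
  have : (2 : ℝ) ≤ n := by exact_mod_cast hn
  exact circleFract_coe_of_lt (by positivity) (by rw [div_lt_one (by linarith)]; linarith)

theorem coe_one_div_ne_zero {n : ℕ} (hn : 2 ≤ n) : ((1 / n : ℝ) : UnitAddCircle) ≠ 0 := by
  intro h
  have := circleFract_one_div hn
  rw [h, circleFract_zero] at this
  have : (0 : ℝ) < 1 / n := by positivity
  linarith

theorem circleHeight_ite {ι : Type*} [Fintype ι] [DecidableEq ι] (s : Finset ι)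
    (a b : UnitAddCircle) :
    circleHeight (fun i => if i ∈ s then a else b) =
      s.card * circleFract a + sᶜ.card * circleFract b := by
  rw [circleHeight, ← Finset.sum_add_sum_compl s]
  congr 1
  · rw [Finset.sum_congr rfl fun i hi => by rw [if_pos hi]]; simp
  · rw [Finset.sum_congr rfl fun i hi => by rw [if_neg (Finset.mem_compl.1 hi)]]; simp

/-! ### The two-block generators. -/

namespace HasUniformHeights

variable {ι : Type*} [Fintype ι] [DecidableEq ι] {Λ : AddSubgroup (ι → UnitAddCircle)} {m : ℕ}

/-- If the element of height `m` has order `p`, then `Λ` is generated by a vector with two blocks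
of coordinates, either `1/p, 1/q` or `1/q, 1/(pq)`. -/
theorem eq_zmultiples_of_addOrderOf_eq_prime {p q : ℕ} (h : HasUniformHeights Λ (p * q) m)
    (hm : 0 < m) (hp : p.Prime) (hq : q.Prime) (hpq : p ≠ q) (hsupp : ∀ i, ∃ x ∈ Λ, x i ≠ 0)
    {x : ι → UnitAddCircle} (hx : x ∈ Λ) (hxm : circleHeight x = m) (hord : addOrderOf x = p) :
    (∃ s : Finset ι, s.card = p * m ∧ sᶜ.card = p * q * m ∧
      Λ = AddSubgroup.zmultiples
        (fun i => if i ∈ s then ((1 / p : ℝ) : UnitAddCircle) else ((1 / q : ℝ) : UnitAddCircle))) ∨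
    (∃ s : Finset ι, s.card = (p * q - 1) * m ∧ sᶜ.card = p * m ∧
      Λ = AddSubgroup.zmultiples
        (fun i => if i ∈ s then ((1 / q : ℝ) : UnitAddCircle)
          else ((1 / (p * q) : ℝ) : UnitAddCircle))) := by
  have hp2 := hp.two_le
  have hq2 := hq.two_le
  have hpR : (2 : ℝ) ≤ p := by exact_mod_cast hp2
  have hqR : (2 : ℝ) ≤ q := by exact_mod_cast hq2
  have hpq2 : 2 ≤ p * q := by nlinarith
  obtain ⟨y, hy, hym⟩ := h.surj p (by nlinarith)
  obtain ⟨hqy, hh⟩ := h.circleHeight_mod_div hm hp hq hx hxm hord hy hym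
  have hall := fun z hz => h.exists_eq_of_forall_eq
    (fun t _ => Λ.add_mem (Λ.nsmul_mem hx (t % p)) (Λ.nsmul_mem hy (t / p))) hh (z := z) hz
  have hgen : ∀ w ∈ Λ, x ∈ AddSubgroup.zmultiples w → y ∈ AddSubgroup.zmultiples w →
      Λ = AddSubgroup.zmultiples w := by
    intro w hw hxw hyw
    apply le_antisymm
    · intro z hz
      obtain ⟨t, -, rfl⟩ := hall z hz
      exact add_mem (nsmul_mem hxw _) (nsmul_mem hyw _)
    · simpa using hw
  have hpx : p • x = 0 := by rw [← hord]; exact addOrderOf_nsmul_eq_zero x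
  -- The largest index pq - 1 has digits p - 1 and q - 1, and its element attains the subadditive
  -- bound; this inequality controls all coordinates below.
  have hlt : ∀ i, (p - 1 : ℝ) * circleFract (x i) + (q - 1) * circleFract (y i) < 1 := by
    intro i
    have hidx : p * q - 1 = (p - 1) + p * (q - 1) := by
      obtain ⟨p', rfl⟩ := Nat.exists_eq_succ_of_ne_zero hp.ne_zero
      obtain ⟨q', rfl⟩ := Nat.exists_eq_succ_of_ne_zero hq.ne_zero
      simp only [Nat.succ_eq_add_one, Nat.add_sub_cancel]
      rw [Nat.sub_eq_iff_eq_add (by nlinarith)]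
      ring
    have h1 := hh (p * q - 1) (by omega)
    have hmod : (p * q - 1) % p = p - 1 := by
      rw [hidx, Nat.add_mul_mod_self_left, Nat.mod_eq_of_lt (by omega)]
    have hdiv : (p * q - 1) / p = q - 1 := by
      rw [hidx, Nat.add_mul_div_left _ _ hp.pos, Nat.div_eq_of_lt (by omega), zero_add]
    rw [hmod, hdiv] at h1
    have h2 : circleHeight ((p - 1) • x + (q - 1) • y) =
        (p - 1 : ℕ) * circleHeight x + (q - 1 : ℕ) * circleHeight y := by
      rw [h1, hxm, hym, hidx]
      push_cast
      ring
    have h3 := circleFract_combination_eq h2 i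
    have h4 := circleFract_lt_one ((p - 1) • x i + (q - 1) • y i)
    rw [h3] at h4
    rwa [Nat.cast_sub hp.one_le, Nat.cast_sub hq.one_le, Nat.cast_one] at h4
  have hxi : ∀ i, x i = 0 ∨ x i = ((1 / p : ℝ) : UnitAddCircle) := by
    intro i
    have := eq_zero_or_eq_one_div (r := 1) one_pos hp2 (x := x i)
      (by simpa using congrFun hpx i) (by
        have h1 := hlt i
        have h2 := circleFract_nonneg (y i)
        have h3 : 0 ≤ (q - 1 : ℝ) * circleFract (y i) := mul_nonneg (by linarith) h2
        rw [Nat.cast_one, div_one]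
        linarith)
    simpa using this
  obtain ⟨c, hc⟩ := hqy
  have hc' : ∀ i, c • x i = q • y i := fun i => congrFun hc i
  set s : Finset ι := Finset.univ.filter fun i => x i ≠ 0 with hs
  have hxs : x = fun i => if i ∈ s then ((1 / p : ℝ) : UnitAddCircle) else 0 := by
    funext i
    rcases hxi i with h1 | h1
    · simp [hs, h1]
    · have := coe_one_div_ne_zero hp2
      rw [← h1] at this
      rw [if_pos (by simp [hs, this]), h1]
  have hys : ∀ i ∈ s, y i = 0 ∨ y i = ((1 / (p * q) : ℝ) : UnitAddCircle) := by
    intro i hi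
    have h1 := hlt i
    rw [hxs] at h1
    simp only [if_pos hi] at h1
    rw [circleFract_one_div hp2] at h1
    refine eq_zero_or_eq_one_div hp.pos hq2 (congrFun (h.nsmul_eq_zero hm hy) i) ?_
    have : (p - 1 : ℝ) * (1 / p) = 1 - 1 / p := by field_simp
    linarith
  -- Here x_i = 0, so q y_i = c x_i = 0 and y_i is 0 or 1/q; the value 0 would make coordinate i
  -- vanish on Λ.
  have hyc : ∀ i ∉ s, y i = ((1 / q : ℝ) : UnitAddCircle) := by
    intro i hi
    have hx0 : x i = 0 := by simpa [hs] using hi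
    have h1 := hlt i
    rw [hx0, circleFract_zero, mul_zero, zero_add] at h1
    have h2 := eq_zero_or_eq_one_div (r := 1) one_pos hq2 (x := y i)
      (by rw [one_mul, ← hc' i, hx0, smul_zero]) (by simpa using h1)
    rcases h2 with h2 | h2
    · obtain ⟨z, hz, hzi⟩ := hsupp i
      obtain ⟨t, -, rfl⟩ := hall z hz
      simp [hx0, h2] at hzi
    · simpa using h2
  have hcards : s.card = p * m := by
    have h1 := hxm
    rw [hxs, circleHeight_ite, circleFract_one_div hp2, circleFract_zero] at h1
    field_simp at h1
    have : (s.card : ℝ) = p * m := by linarith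
    exact_mod_cast this
  have hcardR : (s.card : ℝ) = p * m := by exact_mod_cast hcards
  by_cases hqy0 : q • y = 0
  · left
    have hy0 : ∀ i ∈ s, y i = 0 := by
      intro i hi
      refine (hys i hi).resolve_right fun h1 => ?_
      have h2 : q • y i = 0 := congrFun hqy0 i
      rw [h1, nsmul_coe_one_div hq.pos] at h2
      exact coe_one_div_ne_zero hp2 h2
    have hy' : y = fun i => if i ∈ s then 0 else ((1 / q : ℝ) : UnitAddCircle) := by
      funext i
      by_cases hi : i ∈ s
      · simp [hi, hy0 i hi]
      · simp only [if_neg hi, hyc i hi]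
    have hw : (fun i => if i ∈ s then ((1 / p : ℝ) : UnitAddCircle)
        else ((1 / q : ℝ) : UnitAddCircle)) = x + y := by
      rw [hxs, hy']
      funext i
      by_cases hi : i ∈ s <;> simp [hi]
    refine ⟨s, hcards, ?_, ?_⟩
    · rw [hy', circleHeight_ite, circleFract_one_div hq2, circleFract_zero] at hym
      field_simp at hym
      have : (sᶜ.card : ℝ) = p * q * m := by linarith
      exact_mod_cast this
    · rw [hw]
      obtain ⟨u, v, huv⟩ := (Nat.isCoprime_iff_coprime.2 ((Nat.coprime_primes hp hq).2 hpq))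
      have hpx' : (p : ℤ) • x = 0 := by rw [natCast_zsmul, hpx]
      have hqy' : (q : ℤ) • y = 0 := by rw [natCast_zsmul, hqy0]
      -- From up + vq = 1, the multiple vq of x + y is x and the multiple up is y.
      refine hgen _ (Λ.add_mem hx hy) ⟨v * q, ?_⟩ ⟨u * p, ?_⟩
      · calc (v * q) • (x + y) = (v * q) • x := by rw [smul_add, mul_smul v _ y, hqy', smul_zero,
              add_zero]
          _ = (u * p + v * q) • x := by rw [add_smul, mul_smul u, hpx', smul_zero, zero_add]
          _ = x := by rw [huv, one_smul]
      · calc (u * p) • (x + y) = (u * p) • y := by rw [smul_add, mul_smul u _ x, hpx', smul_zero,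
              zero_add]
          _ = (u * p + v * q) • y := by rw [add_smul, mul_smul v, hqy', smul_zero, add_zero]
          _ = y := by rw [huv, one_smul]
  · right
    obtain ⟨i₀, hi₀⟩ := Function.ne_iff.1 hqy0
    replace hi₀ : q • y i₀ ≠ 0 := hi₀
    have hi₀s : i₀ ∈ s := by
      by_contra hi
      rw [hyc i₀ hi, nsmul_coe_one_div_self hq.pos] at hi₀
      exact hi₀ rfl
    have hy1 : ∀ i ∈ s, y i = ((1 / (p * q) : ℝ) : UnitAddCircle) := by
      intro i hi
      -- Since qy = cx and x is constant on s, so is qy: a zero of y in s would give q y = 0 at i₀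
      -- too.
      refine (hys i hi).resolve_left fun h1 => hi₀ ?_
      have h2 : x i = x i₀ := by rw [hxs]; simp only [if_pos hi, if_pos hi₀s]
      rw [← hc' i₀, ← h2, hc' i, h1, smul_zero]
    have hy' : y = fun i => if i ∈ s then ((1 / (p * q) : ℝ) : UnitAddCircle)
        else ((1 / q : ℝ) : UnitAddCircle) := by
      funext i
      by_cases hi : i ∈ s
      · simp only [if_pos hi, hy1 i hi]
      · simp only [if_neg hi, hyc i hi]
    have hw : (fun i => if i ∈ sᶜ then ((1 / q : ℝ) : UnitAddCircle)
        else ((1 / (p * q) : ℝ) : UnitAddCircle)) = y := by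
      rw [hy']
      funext i
      by_cases hi : i ∈ s <;> simp [hi]
    refine ⟨sᶜ, ?_, by rw [compl_compl, hcards], ?_⟩
    · have h1 := circleFract_one_div hpq2
      push_cast at h1
      rw [hy', circleHeight_ite, circleFract_one_div hq2, h1, hcardR] at hym
      field_simp at hym
      have : (sᶜ.card : ℝ) = ((p * q - 1 : ℕ) : ℝ) * m := by
        rw [Nat.cast_sub (by omega)]
        push_cast
        linarith
      exact_mod_cast this
    · rw [hw]
      refine hgen y hy ⟨q, ?_⟩ (AddSubgroup.mem_zmultiples y)
      change (q : ℤ) • y = x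
      rw [natCast_zsmul, hxs]
      funext i
      rw [Pi.smul_apply]
      by_cases hi : i ∈ s
      · rw [hy1 i hi, nsmul_coe_one_div hq.pos, if_pos hi]
      · rw [hyc i hi, nsmul_coe_one_div_self hq.pos, if_neg hi]

end HasUniformHeights

/-! ### The δ-polynomial counts Λ by height. -/

namespace LatticeSimplex

variable {d : ℕ} (S : LatticeSimplex d)

theorem eq_of_sum_eq {c c' : Fin (d + 1) → ℝ} (h : ∑ i, c i = ∑ i, c' i)
    (hv : ∀ j, ∑ i, c i * S.vertex i j = ∑ i, c' i * S.vertex i j) : c = c' := by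
  have := affineIndependent_iff.1 S.affineIndependent Finset.univ (c - c')
    (by simp [h]) (by
      funext j
      simp [Finset.sum_apply, sub_mul, hv j])
  funext i
  exact sub_eq_zero.1 (this i (Finset.mem_univ i))

theorem mem_toSet_iff (x : Fin d → ℝ) : x ∈ S.toSet ↔
    ∃ c : Fin (d + 1) → ℝ, (∀ i, 0 ≤ c i) ∧ ∑ i, c i = 1 ∧
      ∀ j, ∑ i, c i * S.vertex i j = x j := by
  have h : Set.range (fun (i : Fin (d + 1)) (j : Fin d) => (S.vertex i j : ℝ)) =
      Fintype.linearCombination ℝ (fun i j => (S.vertex i j : ℝ)) ''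
        Set.range fun i : Fin (d + 1) => Pi.single i (1 : ℝ) := by
    rw [← Set.range_comp]
    congr 1
    funext i
    simp
  rw [toSet, h, ← LinearMap.image_convexHull, convexHull_rangle_single_eq_stdSimplex]
  constructor
  · rintro ⟨c, ⟨hc, hc1⟩, rfl⟩
    exact ⟨c, hc, hc1, fun j => by simp [Fintype.linearCombination_apply, Finset.sum_apply]⟩
  · rintro ⟨c, hc, hc1, hx⟩
    refine ⟨c, ⟨hc, hc1⟩, funext fun j => ?_⟩
    rw [← hx j]
    simp [Fintype.linearCombination_apply, Finset.sum_apply]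

/-- The integer points of the `n`-th dilate, in barycentric coordinates. -/
def dilatePoints (n : ℕ) : Set (Fin d → ℤ) :=
  {z | ∃ c : Fin (d + 1) → ℝ, (∀ i, 0 ≤ c i) ∧ ∑ i, c i = n ∧
    ∀ j, ∑ i, c i * S.vertex i j = z j}

theorem finite_dilatePoints (n : ℕ) : (S.dilatePoints n).Finite := by
  set B : Fin d → ℤ := fun j => n * ∑ i, |S.vertex i j| with hB
  refine (Set.finite_Icc (-B) B).subset ?_
  rintro z ⟨c, hc, hcn, hz⟩
  have hle : ∀ j, |z j| ≤ B j := by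
    intro j
    have h1 : |(z j : ℝ)| ≤ n * ∑ i, |(S.vertex i j : ℝ)| := by
      rw [← hz j, Finset.mul_sum]
      refine (Finset.abs_sum_le_sum_abs _ _).trans (Finset.sum_le_sum fun i _ => ?_)
      rw [abs_mul, abs_of_nonneg (hc i), ← hcn]
      exact mul_le_mul_of_nonneg_right
        (Finset.single_le_sum (fun i _ => hc i) (Finset.mem_univ i)) (abs_nonneg _)
    exact_mod_cast h1
  exact ⟨fun j => (abs_le.1 (hle j)).1, fun j => (abs_le.1 (hle j)).2⟩

theorem coeff_ehrhartSeries (n : ℕ) :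
    PowerSeries.coeff n (ehrhartSeries S.toSet) = ((S.dilatePoints n).ncard : ℤ) := by
  rw [ehrhartSeries, PowerSeries.coeff_mk]
  split_ifs with hn
  · subst hn
    have : S.dilatePoints 0 = {0} := by
      ext z
      simp only [dilatePoints, Set.mem_ofPred_eq, Nat.cast_zero, Set.mem_singleton_iff]
      constructor
      · rintro ⟨c, hc, hc0, hz⟩
        have hc' := (Finset.sum_eq_zero_iff_of_nonneg fun i _ => hc i).1 hc0
        funext j
        have := hz j
        rw [Finset.sum_eq_zero fun i hi => by rw [hc' i hi, zero_mul]] at this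
        exact_mod_cast this.symm
      · rintro rfl
        exact ⟨0, by simp, by simp, by simp⟩
    simp [this]
  · rw [latticePointCount]
    congr 2
    have hn' : (0 : ℝ) < n := by positivity
    ext z
    simp only [Set.mem_ofPred_eq, dilatePoints, Set.mem_smul_set, mem_toSet_iff]
    constructor
    · rintro ⟨y, ⟨c, hc, hc1, hy⟩, hyz⟩
      refine ⟨fun i => n * c i, fun i => mul_nonneg hn'.le (hc i), ?_, fun j => ?_⟩
      · rw [← Finset.mul_sum, hc1, mul_one]
      · rw [← congrFun hyz j, Pi.smul_apply, smul_eq_mul, ← hy j, Finset.mul_sum]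
        exact Finset.sum_congr rfl fun i _ => mul_assoc _ _ _
    · rintro ⟨c, hc, hcn, hz⟩
      refine ⟨(n : ℝ)⁻¹ • fun j => (z j : ℝ), ⟨fun i => (n : ℝ)⁻¹ * c i,
        fun i => mul_nonneg (by positivity) (hc i), ?_, fun j => ?_⟩, ?_⟩
      · rw [← Finset.mul_sum, hcn, inv_mul_cancel₀ hn'.ne']
      · rw [Pi.smul_apply, smul_eq_mul, ← hz j, Finset.mul_sum]
        exact Finset.sum_congr rfl fun i _ => mul_assoc _ _ _
      · rw [smul_inv_smul₀ hn'.ne']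

theorem coe_mem_Lam_iff (c : Fin (d + 1) → ℝ) :
    (fun i => (c i : UnitAddCircle)) ∈ S.Lam ↔
      (∀ j, ∃ z : ℤ, ∑ i, c i * S.vertex i j = z) ∧ ∃ z : ℤ, ∑ i, c i = z := by
  have key : ∀ r : ℝ, (r : UnitAddCircle) = 0 ↔ ∃ z : ℤ, r = z := by
    intro r
    rw [AddCircle.coe_eq_zero_iff]
    simp [eq_comm]
  have hsum : ∀ f : Fin (d + 1) → ℝ, ∑ i, (f i : UnitAddCircle) =
      ((∑ i, f i : ℝ) : UnitAddCircle) :=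
    fun f => (map_sum (QuotientAddGroup.mk' (AddSubgroup.zmultiples (1 : ℝ))) f _).symm
  change ((∀ j, ∑ i, S.vertex i j • (c i : UnitAddCircle) = 0) ∧
    ∑ i, (c i : UnitAddCircle) = 0) ↔ _
  rw [hsum, key]
  refine and_congr (forall_congr' fun j => ?_) Iff.rfl
  rw [← key, ← hsum]
  refine Eq.congr (Finset.sum_congr rfl fun i _ => ?_) rfl
  rw [← AddCircle.coe_zsmul, zsmul_eq_mul, mul_comm]

theorem exists_circleHeight_eq {x : Fin (d + 1) → UnitAddCircle} (hx : x ∈ S.Lam) :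
    ∃ n : ℕ, circleHeight x = n := by
  have h := (S.coe_mem_Lam_iff fun i => circleFract (x i)).1 (by simpa [coe_circleFract] using hx)
  obtain ⟨z, hz⟩ := h.2
  have h0 : (0 : ℝ) ≤ z := hz ▸ circleHeight_nonneg x
  lift z to ℕ using (by exact_mod_cast h0)
  exact ⟨z, hz⟩

/-- The elements of `Λ` of height `n`. -/
def heightSet (n : ℕ) : Set (Fin (d + 1) → UnitAddCircle) :=
  {x | x ∈ S.Lam ∧ circleHeight x = n}

/-- Elements of `Λ` together with natural shifts of the coordinates, of total height `n`. -/
def shiftedPoints (n : ℕ) : Set ((Fin (d + 1) → UnitAddCircle) × (Fin (d + 1) →₀ ℕ)) :=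
  {P | P.1 ∈ S.Lam ∧ circleHeight P.1 + ∑ i, (P.2 i : ℝ) = n}

/-- A lattice point of the dilate has unique barycentric coordinates of sum n. Their classes mod 1
give an element of Λ, their floors the natural shifts. -/
theorem exists_bijOn_shiftedPoints (n : ℕ) :
    ∃ f, Set.BijOn f (S.shiftedPoints n) (S.dilatePoints n) := by
  set g : (Fin (d + 1) → UnitAddCircle) × (Fin (d + 1) →₀ ℕ) → Fin (d + 1) → ℝ :=
    fun P i => circleFract (P.1 i) + P.2 i with hg
  have hgc : ∀ P, (fun i => (g P i : UnitAddCircle)) = P.1 := by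
    intro P
    funext i
    have : ((P.2 i : ℝ) : UnitAddCircle) = 0 :=
      (AddCircle.coe_eq_zero_iff 1).2 ⟨P.2 i, by simp⟩
    simp only [hg, AddCircle.coe_add, coe_circleFract, this, add_zero]
  have hg0 : ∀ P i, 0 ≤ g P i := fun P i => add_nonneg (circleFract_nonneg _) (Nat.cast_nonneg _)
  have hgs : ∀ P ∈ S.shiftedPoints n, ∑ i, g P i = n := by
    intro P hP
    rw [← hP.2, hg, Finset.sum_add_distrib, circleHeight]
  -- The membership hypothesis sits inside the existential so that `choose` gives a total map;
  -- outside the set its value is irrelevant.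
  have hf : ∀ P, ∃ z : Fin d → ℤ, P ∈ S.shiftedPoints n → ∀ j, ∑ i, g P i * S.vertex i j = z j := by
    intro P
    by_cases hP : P ∈ S.shiftedPoints n
    · have h1 := hP.1
      rw [← hgc P, coe_mem_Lam_iff] at h1
      choose z hz using h1.1
      exact ⟨z, fun _ => hz⟩
    · exact ⟨0, fun h => absurd h hP⟩
  choose f hf using hf
  refine ⟨f, fun P hP => ⟨g P, hg0 P, hgs P hP, hf P hP⟩, ?_, ?_⟩
  · intro P hP Q hQ hPQ
    have h1 : g P = g Q := S.eq_of_sum_eq (by rw [hgs P hP, hgs Q hQ])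
      fun j => by rw [hf P hP, hf Q hQ, hPQ]
    have h2 : P.1 = Q.1 := by rw [← hgc P, ← hgc Q, h1]
    refine Prod.ext h2 (Finsupp.ext fun i => ?_)
    have h3 := congrFun h1 i
    simp only [hg, h2, add_right_inj] at h3
    exact_mod_cast h3
  · rintro z ⟨c, hc, hcn, hz⟩
    set P : (Fin (d + 1) → UnitAddCircle) × (Fin (d + 1) →₀ ℕ) :=
      (fun i => (c i : UnitAddCircle), Finsupp.equivFunOnFinite.symm fun i => ⌊c i⌋₊) with hP
    have hgP : g P = c := by
      funext i
      simp only [hg, hP, Finsupp.equivFunOnFinite_symm_apply_apply, circleFract_coe]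
      rw [natCast_floor_eq_intCast_floor (hc i), Int.fract_add_floor]
    have hPm : P ∈ S.shiftedPoints n := by
      refine ⟨(S.coe_mem_Lam_iff c).2 ⟨fun j => ⟨z j, hz j⟩, n, by simpa using hcn⟩, ?_⟩
      rw [← hcn, ← hgP, hg, Finset.sum_add_distrib, circleHeight]
    refine ⟨P, hPm, funext fun j => ?_⟩
    have := hf P hPm j
    rw [hgP, hz j] at this
    exact_mod_cast this.symm

theorem finite_shiftedPoints (n : ℕ) : (S.shiftedPoints n).Finite := by
  obtain ⟨f, hf⟩ := S.exists_bijOn_shiftedPoints n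
  exact hf.finite_iff_finite.2 (S.finite_dilatePoints n)

theorem finite_heightSet (n : ℕ) : (S.heightSet n).Finite := by
  refine Set.Finite.of_finite_image (f := fun x => (x, (0 : Fin (d + 1) →₀ ℕ)))
    ((S.finite_shiftedPoints n).subset ?_) fun x _ y _ h => congrArg Prod.fst h
  rintro _ ⟨x, hx, rfl⟩
  exact ⟨hx.1, by simpa using hx.2⟩

/-- Heights on Λ are natural numbers, so the shifted points split by height and total shift, and the
count is a convolution. -/
theorem ncard_dilatePoints (n : ℕ) : (S.dilatePoints n).ncard =
    ∑ P ∈ Finset.HasAntidiagonal.antidiagonal n, (S.heightSet P.1).ncard *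
      ((Finset.univ : Finset (Fin (d + 1))).finsuppAntidiag P.2).card := by
  obtain ⟨f, hf⟩ := S.exists_bijOn_shiftedPoints n
  classical
  have h : S.shiftedPoints n = ((Finset.HasAntidiagonal.antidiagonal n).biUnion fun P =>
      (S.finite_heightSet P.1).toFinset ×ˢ
        (Finset.univ : Finset (Fin (d + 1))).finsuppAntidiag P.2 : Finset _) := by
    ext ⟨x, a⟩
    simp only [shiftedPoints, Set.mem_ofPred_eq, Finset.coe_biUnion, Set.mem_iUnion,
      Finset.mem_coe, Finset.HasAntidiagonal.mem_antidiagonal, Finset.mem_product,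
      Set.Finite.mem_toFinset,
      Finset.mem_finsuppAntidiag, heightSet, Finset.subset_univ, and_true, exists_prop]
    constructor
    · rintro ⟨hx, hn⟩
      obtain ⟨k, hk⟩ := S.exists_circleHeight_eq hx
      refine ⟨(k, ∑ i, a i), ?_, ⟨hx, hk⟩, rfl⟩
      rw [hk] at hn
      exact_mod_cast hn
    · rintro ⟨⟨k, l⟩, hkl, ⟨hx, hk⟩, hl⟩
      refine ⟨hx, ?_⟩
      simp only at hk hl hkl
      rw [hk, ← hkl, ← hl]
      push_cast
      rfl
  rw [← hf.image_eq, hf.injOn.ncard_image, h, Set.ncard_coe_finset,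
    Finset.card_biUnion]
  · refine Finset.sum_congr rfl fun P _ => ?_
    rw [Finset.card_product, Set.ncard_eq_toFinset_card _ (S.finite_heightSet P.1)]
  · intro P hP Q hQ hPQ
    rw [Function.onFun, Finset.disjoint_left]
    rintro ⟨x, a⟩ h1 h2
    simp only [Finset.mem_product, Set.Finite.mem_toFinset, heightSet, Set.mem_ofPred_eq,
      Finset.mem_finsuppAntidiag] at h1 h2
    apply hPQ
    refine Prod.ext ?_ (h1.2.1.symm.trans h2.2.1)
    exact_mod_cast h1.1.2.symm.trans h2.1.2

/-- The coefficients of the `δ`-polynomial count the elements of `Λ` by height. -/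
theorem coeff_eq_ncard_heightSet {f : Polynomial ℤ} (hf : HasDeltaPolynomial S.toSet f) (n : ℕ) :
    f.coeff n = (S.heightSet n).ncard := by
  have h1 : ehrhartSeries S.toSet =
      PowerSeries.mk (fun n => ((S.heightSet n).ncard : ℤ)) * (PowerSeries.mk 1) ^ (d + 1) := by
    ext n
    rw [coeff_ehrhartSeries, ncard_dilatePoints, PowerSeries.coeff_mul, Nat.cast_sum]
    refine Finset.sum_congr rfl fun P _ => ?_
    -- The shifts of given total are counted by a product of d + 1 geometric series, which cancels
    -- against (1 - t)^(d+1).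
    have : (PowerSeries.mk 1 : PowerSeries ℤ) ^ (d + 1) =
      ∏ _i : Fin (d + 1), PowerSeries.mk 1 := by simp
    rw [this, PowerSeries.coeff_prod]
    simp
  have h2 : (f : PowerSeries ℤ) = PowerSeries.mk (fun n => ((S.heightSet n).ncard : ℤ)) := by
    rw [hf, h1, mul_left_comm, ← mul_pow, mul_comm (1 - _),
      PowerSeries.mk_one_mul_one_sub_eq_one, one_pow, mul_one]
  rw [← Polynomial.coeff_coe, h2, PowerSeries.coeff_mk]

theorem hasUniformHeights {N m : ℕ} (hm : 0 < m)
    (hf : HasDeltaPolynomial S.toSet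
      (∑ i ∈ Finset.range N, (Polynomial.X : Polynomial ℤ) ^ (i * m))) :
    HasUniformHeights S.Lam N m := by
  have hc := S.coeff_eq_ncard_heightSet hf
  simp only [Polynomial.finsetSum_coeff, Polynomial.coeff_X_pow] at hc
  have hval : ∀ x ∈ S.Lam, ∃ t < N, circleHeight x = ((t * m : ℕ) : ℝ) := by
    intro x hx
    obtain ⟨n, hn⟩ := S.exists_circleHeight_eq hx
    by_contra! hne
    have h1 := hc n
    rw [Finset.sum_eq_zero fun i hi => by
      rw [if_neg]
      rintro rfl
      exact hne i (Finset.mem_range.1 hi) hn] at h1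
    have h2 : (S.heightSet n).ncard = 0 := by exact_mod_cast h1.symm
    rw [Set.ncard_eq_zero (S.finite_heightSet n)] at h2
    exact Set.notMem_empty x (h2 ▸ ⟨hx, hn⟩)
  have hone : ∀ t < N, (S.heightSet (t * m)).ncard = 1 := by
    intro t ht
    have h1 := hc (t * m)
    simp only [mul_left_inj' hm.ne'] at h1
    rw [Finset.sum_ite_eq, if_pos (Finset.mem_range.2 ht)] at h1
    exact_mod_cast h1.symm
  refine ⟨fun x hx y hy hxy => ?_, fun x hx => by simpa using hval x hx, fun t ht => ?_⟩
  · obtain ⟨t, ht, hxt⟩ := hval x hx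
    obtain ⟨z, hz⟩ := Set.ncard_eq_one.1 (hone t ht)
    have h1 : x ∈ S.heightSet (t * m) := ⟨hx, hxt⟩
    have h2 : y ∈ S.heightSet (t * m) := ⟨hy, hxy ▸ hxt⟩
    rw [hz] at h1 h2
    exact h1.trans h2.symm
  · obtain ⟨z, hz⟩ := Set.ncard_eq_one.1 (hone t ht)
    have h1 : z ∈ S.heightSet (t * m) := by rw [hz]; rfl
    exact ⟨z, h1.1, by simpa using h1.2⟩

end LatticeSimplex

/-! ### A coordinate vanishing on Λ gives a lattice pyramid. -/

namespace LatticeSimplex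

/-- The vertices of a lattice simplex as an affine basis. -/
noncomputable def affineBasis {d : ℕ} (S : LatticeSimplex d) :
    AffineBasis (Fin (d + 1)) ℝ (Fin d → ℝ) :=
  ⟨fun i j => (S.vertex i j : ℝ), S.affineIndependent,
    S.affineIndependent.affineSpan_eq_top_iff_card_eq_finrank_add_one.2 (by simp)⟩

/-- If the coordinate `i₀` vanishes on `Λ`, the barycentric coordinate `i₀` is an integer at
integer points. -/
theorem exists_intCast_eq_coord {d : ℕ} (S : LatticeSimplex d) {i₀ : Fin (d + 1)}
    (h : ∀ x ∈ S.Lam, x i₀ = 0) (z : Fin d → ℤ) :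
    ∃ a : ℤ, S.affineBasis.coord i₀ (fun j => (z j : ℝ)) = a := by
  set c : Fin (d + 1) → ℝ := fun i => S.affineBasis.coord i (fun j => (z j : ℝ)) with hc
  have h1 : ∑ i, c i = 1 := S.affineBasis.sum_coord_apply_eq_one _
  have h2 := S.affineBasis.linear_combination_coord_eq_self (fun j => (z j : ℝ))
  -- The barycentric coordinates of an integer point, taken mod 1, form an element of Λ.
  have h3 : (fun i => (c i : UnitAddCircle)) ∈ S.Lam := by
    refine (S.coe_mem_Lam_iff c).2 ⟨fun j => ⟨z j, ?_⟩, 1, by simpa using h1⟩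
    have := congrFun h2 j
    simp only [Finset.sum_apply, Pi.smul_apply, smul_eq_mul] at this
    exact this
  obtain ⟨a, ha⟩ := (AddCircle.coe_eq_zero_iff 1).1 (h _ h3)
  exact ⟨a, by simpa using ha.symm⟩

/-- If the coordinate `i₀` vanishes on `Λ`, some integral linear form takes the value `1` on the
edges from the opposite facet to the vertex `i₀`, and `0` on the edges of that facet. -/
theorem exists_linearMap_vertex_sub {d : ℕ} (S : LatticeSimplex d) {i₀ : Fin (d + 1)}
    (h : ∀ x ∈ S.Lam, x i₀ = 0) :
    ∃ f : (Fin d → ℤ) →ₗ[ℤ] ℤ, (∀ j ≠ i₀, f (S.vertex i₀ - S.vertex j) = 1) ∧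
      ∀ i ≠ i₀, ∀ j ≠ i₀, f (S.vertex i - S.vertex j) = 0 := by
  set F := (S.affineBasis.coord i₀).linear with hF
  have hFsub : ∀ x y : Fin d → ℤ, F (fun j => ((x - y) j : ℝ)) =
      S.affineBasis.coord i₀ (fun j => (x j : ℝ)) -
        S.affineBasis.coord i₀ (fun j => (y j : ℝ)) := by
    intro x y
    rw [← vsub_eq_sub (S.affineBasis.coord i₀ _), ← AffineMap.linearMap_vsub, hF]
    congr 1
    funext j
    simp
  have hFz : ∀ z : Fin d → ℤ, ∃ a : ℤ, F (fun j => (z j : ℝ)) = a := by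
    intro z
    obtain ⟨a, ha⟩ := S.exists_intCast_eq_coord h z
    obtain ⟨b, hb⟩ := S.exists_intCast_eq_coord h 0
    refine ⟨a - b, ?_⟩
    have := hFsub z 0
    rw [sub_zero, ha, hb] at this
    exact_mod_cast this
  choose f hf using hFz
  have hadd : ∀ x y, f (x + y) = f x + f y := by
    intro x y
    have : F (fun j => ((x + y) j : ℝ)) = F (fun j => (x j : ℝ)) + F (fun j => (y j : ℝ)) := by
      rw [← map_add]
      congr 1
      funext j
      simp
    rw [hf, hf, hf] at this
    exact_mod_cast this
  have hcoord : ∀ i, S.affineBasis.coord i₀ (fun j => (S.vertex i j : ℝ)) =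
      if i₀ = i then 1 else 0 := fun i => S.affineBasis.coord_apply i₀ i
  refine ⟨(AddMonoidHom.mk' f hadd).toIntLinearMap, fun j hj => ?_, fun i hi j hj => ?_⟩
  · change f _ = 1
    have := hFsub (S.vertex i₀) (S.vertex j)
    rw [hf, hcoord, hcoord, if_pos rfl, if_neg hj.symm] at this
    exact_mod_cast this.trans (sub_zero _)
  · change f _ = 0
    have := hFsub (S.vertex i) (S.vertex j)
    rw [hf, hcoord, hcoord, if_neg hi.symm, if_neg hj.symm] at this
    exact_mod_cast this.trans (sub_zero _)

/-- Every z is f(z)u plus an element of the kernel, so the lattice is ℤu ⊕ ker f, and the kernel is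
free. -/
theorem _root_.exists_basis_ker_of_apply_eq_one {e : ℕ} (f : (Fin (e + 1) → ℤ) →ₗ[ℤ] ℤ)
    {u : Fin (e + 1) → ℤ} (hu : f u = 1) :
    ∃ (b : Module.Basis (Fin e) ℤ (LinearMap.ker f))
      (B : Module.Basis (Fin (e + 1)) ℤ (Fin (e + 1) → ℤ)),
      B (Fin.last e) = u ∧ ∀ i : Fin e, B i.castSucc = b i := by
  obtain ⟨n, ⟨b⟩⟩ := Submodule.nonempty_basis_of_pid (Pi.basisFun ℤ (Fin (e + 1))) (LinearMap.ker f)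
  have hli : ∀ c : ℤ, ∀ x ∈ LinearMap.ker f, c • u + x = 0 → c = 0 := by
    intro c x hx hcx
    have := congrArg f hcx
    rw [map_add, map_smul, hu, LinearMap.mem_ker.1 hx] at this
    simpa using this
  have hsp : ∀ z, ∃ c : ℤ, z + c • u ∈ LinearMap.ker f := fun z =>
    ⟨-f z, by rw [LinearMap.mem_ker, map_add, map_smul, hu]; simp⟩
  let B := Module.Basis.mkFinCons u b hli hsp
  have hn : n = e := by
    have h1 := Module.finrank_eq_card_basis B
    have h2 := Module.finrank_eq_card_basis (Pi.basisFun ℤ (Fin (e + 1)))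
    rw [h1] at h2
    simpa using h2
  subst hn
  -- `mkFinCons` lists u first; the rotation moves it to the last place, that of the apex direction.
  refine ⟨b, B.reindex (finRotate (n + 1)).symm, ?_, fun i => ?_⟩
  · simp [B]
  · rw [Module.Basis.reindex_apply, Equiv.symm_symm,
      show finRotate (n + 1) i.castSucc = i.succ from finRotate_of_lt i.is_lt]
    simp [B]

/-- The rows of U are a basis of the kernel of the form followed by the edge from v_{j₀} to v_{i₀}.
In these coordinates, with origin v_{j₀}, the facet opposite v_{i₀} lies at height 0 and v_{i₀} is
the last unit vector. -/
theorem isLatticePyramid_of_forall_eq_zero {e : ℕ} (S : LatticeSimplex (e + 1))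
    {i₀ : Fin (e + 1 + 1)} (h : ∀ x ∈ S.Lam, x i₀ = 0) : S.IsLatticePyramid := by
  obtain ⟨f, hf1, hf0⟩ := S.exists_linearMap_vertex_sub h
  set j₀ := i₀.succAbove 0 with hj₀
  have hj₀i : j₀ ≠ i₀ := i₀.succAbove_ne 0
  obtain ⟨b, B, hBl, hBc⟩ := exists_basis_ker_of_apply_eq_one f (hf1 j₀ hj₀i)
  set U : Matrix (Fin (e + 1)) (Fin (e + 1)) ℤ := Matrix.of fun r => B r with hU
  have hdet : U.det = 1 ∨ U.det = -1 := by
    rw [← Int.isUnit_iff]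
    have h1 := (Pi.basisFun ℤ (Fin (e + 1))).isUnit_det B
    rw [Module.Basis.det_apply, ← Matrix.det_transpose] at h1
    have h2 : U = ((Pi.basisFun ℤ (Fin (e + 1))).toMatrix B).transpose := by
      ext r j
      simp [hU, Module.Basis.toMatrix_apply]
    rwa [h2]
  set t : Fin (e + 1) → Fin e → ℤ := fun i =>
    b.repr ⟨S.vertex (i₀.succAbove i) - S.vertex j₀,
      hf0 _ (i₀.succAbove_ne i) _ hj₀i⟩ with ht
  have htsum : ∀ i, ∑ r, t i r • B r.castSucc = S.vertex (i₀.succAbove i) - S.vertex j₀ := by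
    intro i
    have := congrArg Subtype.val (b.sum_repr ⟨S.vertex (i₀.succAbove i) - S.vertex j₀,
      hf0 _ (i₀.succAbove_ne i) _ hj₀i⟩)
    simp only [AddSubmonoidClass.coe_finsetSum, Submodule.coe_smul] at this
    simpa [hBc] using this
  let φ : (Fin (e + 1) → ℝ) →ᵃ[ℝ] (Fin (e + 1) → ℝ) :=
    (Matrix.vecMulLinear (U.map fun z : ℤ => (z : ℝ))).toAffineMap +
      AffineMap.const ℝ _ (fun j => (S.vertex j₀ j : ℝ))
  have hφ : ∀ v, φ v = Matrix.vecMul v (U.map fun z : ℤ => (z : ℝ)) +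
      fun j => (S.vertex j₀ j : ℝ) := fun v => rfl
  let ι : (Fin e → ℝ) →ₗ[ℝ] (Fin (e + 1) → ℝ) :=
    { toFun := fun x => Fin.snoc x 0
      map_add' := fun x y => by
        funext r
        refine Fin.lastCases ?_ (fun r => ?_) r <;> simp
      map_smul' := fun c x => by
        funext r
        refine Fin.lastCases ?_ (fun r => ?_) r <;> simp }
  have hι : ∀ x, ι x = (Fin.snoc x 0 : Fin (e + 1) → ℝ) := fun x => rfl
  have hφt : ∀ i, φ (ι fun r => (t i r : ℝ)) =
      fun j => (S.vertex (i₀.succAbove i) j : ℝ) := by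
    intro i
    funext j
    have := congrFun (htsum i) j
    rw [Finset.sum_apply] at this
    simp only [Pi.smul_apply, smul_eq_mul, Pi.sub_apply] at this
    rw [hφ, hι, Pi.add_apply, Matrix.vecMul, dotProduct, Fin.sum_univ_castSucc]
    simp only [Fin.snoc_castSucc, Fin.snoc_last, zero_mul, add_zero, Matrix.map_apply, hU,
      Matrix.of_apply]
    rw [← eq_sub_iff_add_eq]
    exact_mod_cast this
  have hφl : φ (Pi.single (Fin.last e) 1) = fun j => (S.vertex i₀ j : ℝ) := by
    funext j
    rw [hφ, Pi.add_apply, Matrix.single_one_vecMul]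
    simp [hU, hBl]
  have haff : AffineIndependent ℝ (fun i j => (t i j : ℝ) : Fin (e + 1) → Fin e → ℝ) := by
    refine AffineIndependent.of_comp (φ.comp ι.toAffineMap) ?_
    have : (φ.comp ι.toAffineMap) ∘ (fun i j => (t i j : ℝ) : Fin (e + 1) → Fin e → ℝ) =
        (fun i j => (S.vertex i j : ℝ) : Fin (e + 1 + 1) → Fin (e + 1) → ℝ) ∘
          i₀.succAboveEmb := by
      funext i
      exact hφt i
    rw [this]
    exact S.affineIndependent.comp_embedding _
  refine ⟨⟨t, haff⟩, U, S.vertex j₀, hdet, ?_⟩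
  change S.toSet = φ '' latticePyramid _
  have hpyr : latticePyramid (toSet ⟨t, haff⟩) = convexHull ℝ
      (insert (Pi.single (Fin.last e) 1) (ι '' Set.range fun i r => (t i r : ℝ))) := by
    rw [latticePyramid, toSet]
    change convexHull ℝ (insert _ (ι '' convexHull ℝ _)) = _
    rw [LinearMap.image_convexHull, Set.insert_eq, convexHull_convexHull_union_right,
      ← Set.insert_eq]
  rw [hpyr, AffineMap.image_convexHull, Set.image_insert_eq, hφl, ← Set.range_comp,
    ← Set.range_comp, toSet]
  congr 1
  ext x
  simp only [Set.mem_range, Set.mem_insert_iff, Function.comp_apply, hφt]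
  constructor
  · rintro ⟨i, rfl⟩
    rcases Fin.eq_self_or_eq_succAbove i₀ i with rfl | ⟨j, rfl⟩
    · exact Or.inl rfl
    · exact Or.inr ⟨j, rfl⟩
  · rintro (rfl | ⟨j, rfl⟩)
    · exact ⟨i₀, rfl⟩
    · exact ⟨_, rfl⟩

end LatticeSimplex

/-! ### Assembling the five cases. -/

theorem LatticeSimplex.lamGeneratedBy_twoBlocks {d : ℕ} {S : LatticeSimplex d}
    {s : Finset (Fin (d + 1))} {n : ℕ} {a b : ℝ} (hs : s.card = n)
    (h : S.Lam = AddSubgroup.zmultiples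
      (fun i => if i ∈ s then (a : UnitAddCircle) else (b : UnitAddCircle))) :
    S.LamGeneratedBy (twoBlocks (d + 1) n a b) := by
  have hle : n ≤ d + 1 := by simpa [hs] using s.card_le_univ
  have hcard : Fintype.card {i // i ∈ s} = Fintype.card {i : Fin (d + 1) // (i : ℕ) < n} := by
    rw [Fintype.card_coe, hs, Fintype.card_subtype, Fin.card_filter_val_lt, min_eq_right hle]
  let σ := (Fintype.equivOfCardEq hcard).extendSubtype
  refine ⟨σ, ?_⟩
  rw [h]
  congr 1
  funext i
  by_cases hi : i ∈ s
  · have := (Fintype.equivOfCardEq hcard).extendSubtype_mem i hi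
    simp only [Function.comp_apply, twoBlocks, if_pos hi, σ, if_pos this]
  · have := (Fintype.equivOfCardEq hcard).extendSubtype_not_mem i hi
    simp only [Function.comp_apply, twoBlocks, if_neg hi, σ, if_neg this]

theorem theorem3p5 (p q k d : ℕ) (hp : p.Prime) (hq : q.Prime) (hpq : p ≠ q)
    (S : LatticeSimplex d)
    (hδ : HasDeltaPolynomial S.toSet
      (∑ i ∈ Finset.range (p * q), (Polynomial.X : Polynomial ℤ) ^ (i * (k + 1))))
    (hS : ¬ S.IsLatticePyramid) :
    (d = p * q * (k + 1) - 1 ∧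
      S.LamGeneratedBy (fun _ => ((1 / (p * q : ℝ) : ℝ) : UnitAddCircle))) ∨
    (d = p * q * (k + 1) + p * (k + 1) - 1 ∧
      S.LamGeneratedBy (twoBlocks (d + 1) (p * (k + 1)) (1 / p) (1 / q))) ∨
    (d = p * q * (k + 1) + q * (k + 1) - 1 ∧
      S.LamGeneratedBy (twoBlocks (d + 1) (q * (k + 1)) (1 / q) (1 / p))) ∨
    (d = p * q * (k + 1) + (p - 1) * (k + 1) - 1 ∧
      S.LamGeneratedBy (twoBlocks (d + 1) ((p * q - 1) * (k + 1)) (1 / q) (1 / (p * q)))) ∨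
    (d = p * q * (k + 1) + (q - 1) * (k + 1) - 1 ∧
      S.LamGeneratedBy (twoBlocks (d + 1) ((p * q - 1) * (k + 1)) (1 / p) (1 / (p * q)))) := by
  have hm : 0 < k + 1 := k.succ_pos
  have hN : 2 ≤ p * q := by nlinarith [hp.two_le, hq.two_le]
  have h := S.hasUniformHeights hm hδ
  have hsupp : ∀ i, ∃ x ∈ S.Lam, x i ≠ 0 := by
    intro i
    by_contra! hi
    cases d with
    | zero =>
      -- In dimension 0 there are no pyramids, but Λ has a single coordinate; its vanishing
      -- contradicts |Λ| = pq ≥ 2.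
      have h1 : ∀ x ∈ S.Lam, x = 0 := fun x hx =>
        funext fun j => by rw [Fin.subsingleton_one.elim j i]; exact hi x hx
      have h2 := h.natCard_eq hm
      have : Subsingleton S.Lam :=
        ⟨fun x y => Subtype.ext ((h1 x x.2).trans (h1 y y.2).symm)⟩
      rw [Nat.card_of_subsingleton (0 : S.Lam)] at h2
      omega
    | succ e => exact hS (S.isLatticePyramid_of_forall_eq_zero hi)
  obtain ⟨x, hx, hxm⟩ := h.surj 1 (by omega)
  rw [Nat.cast_one, one_mul] at hxm
  have hd : ∀ s : Finset (Fin (d + 1)), s.card + sᶜ.card = d + 1 := by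
    intro s
    rw [Finset.card_add_card_compl, Fintype.card_fin]
  have hx1 : addOrderOf x ≠ 1 := by
    intro h1
    rw [AddMonoid.addOrderOf_eq_one_iff] at h1
    rw [h1, circleHeight] at hxm
    simp at hxm
    linarith
  -- Relates the truncated products to the full ones, so that `omega` can treat them as atoms.
  have hsub : ∀ r : ℕ, 1 ≤ r → r * (k + 1) = (r - 1) * (k + 1) + (k + 1) := by
    intro r hr
    obtain ⟨r, rfl⟩ := Nat.exists_eq_add_of_le' hr
    rw [Nat.add_sub_cancel, add_one_mul]
  have hp1 := hsub p hp.one_le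
  have hq1 := hsub q hq.one_le
  have hpq1 := hsub (p * q) (by omega)
  obtain ⟨a, b, ha, hb, hab⟩ := Nat.dvd_mul.1
    (addOrderOf_dvd_of_nsmul_eq_zero (h.nsmul_eq_zero hm hx))
  -- The order of x is 1, q, p or pq, in this order of goals.
  rcases (Nat.dvd_prime hp).1 ha with rfl | rfl <;> rcases (Nat.dvd_prime hq).1 hb with rfl | rfl
  · exact absurd hab.symm hx1
  · rw [one_mul] at hab
    rw [mul_comm p b] at h
    rcases h.eq_zmultiples_of_addOrderOf_eq_prime hm hq hp hpq.symm hsupp hx hxm hab.symm with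
      ⟨s, hs, hsc, hL⟩ | ⟨s, hs, hsc, hL⟩
    · refine Or.inr (Or.inr (Or.inl ⟨?_, LatticeSimplex.lamGeneratedBy_twoBlocks hs hL⟩))
      have := hd s
      rw [mul_comm b p] at hsc
      omega
    · rw [mul_comm b p] at hs
      rw [mul_comm (b : ℝ) p] at hL
      refine Or.inr (Or.inr (Or.inr (Or.inr
        ⟨?_, LatticeSimplex.lamGeneratedBy_twoBlocks hs hL⟩)))
      have := hd s
      omega
  · rw [mul_one] at hab
    rcases h.eq_zmultiples_of_addOrderOf_eq_prime hm hp hq hpq hsupp hx hxm hab.symm with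
      ⟨s, hs, hsc, hL⟩ | ⟨s, hs, hsc, hL⟩
    · refine Or.inr (Or.inl ⟨?_, LatticeSimplex.lamGeneratedBy_twoBlocks hs hL⟩)
      have := hd s
      omega
    · refine Or.inr (Or.inr (Or.inr (Or.inl
        ⟨?_, LatticeSimplex.lamGeneratedBy_twoBlocks hs hL⟩)))
      have := hd s
      omega
  · obtain ⟨hc, hL⟩ := h.eq_zmultiples_of_addOrderOf_eq hm hN hsupp hx hxm hab.symm
    refine Or.inl ⟨?_, 1, ?_⟩
    · rw [Fintype.card_fin] at hc
      omega
    · rw [hL, Nat.cast_mul]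
      rfl
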